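/- **Construction.** Let $K,q\in(0,1)$ and let $(m_k)_{k\ge 0}$ be a nondecreasing sequence of positive integers. Put $N_k:=\sqrt{4^{m_0\cdots m_k}}=2^{m_0\cdots m_k}$. Choose decreasing sequences of positive reals $(p_k)$, $(a_k)$ with $$2p_0+a_0=1,\qquad N_k\,p_{k+1}+(N_k-1)\,a_{k+1}=p_k,\qquad \frac{p_k}{a_k}<\frac{Kq^{m_k}}{\sqrt2}\qquad(k\ge 0).$$ Let $\Omega_0:=\{1,2,3,4\}$, $\Omega_{k+1}:=(\Omega_k)^{m_k}$ and $\Omega:=\prod_{k\ge0}\Omega_k$. Choose closed axis-parallel squares $I_\alpha\subset\mathbb R^2$ of side $p_k$ for $\alpha\in\Omega_0\times\cdots\times\Omega_k$, $k\ge 0$, such that $I_{(1)},\dots,I_{(4)}$ have lower left corners $(0,0),(p_0+a_0,0),(0,p_0+a_0),(p_0+a_0,p_0+a_0)$, and such that for every $\alpha\in\Omega_0\times\cdots\times\Omega_k$ with $I_\alpha=[u,u+p_k]\times[v,v+p_k]$ the squares $I_{\alpha\hat{\ }\beta}$, $\beta\in\Omega_{k+1}$, are pairwise disjoint and each has lower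 left corner $(u+i(p_{k+1}+a_{k+1}),\,v+j(p_{k+1}+a_{k+1}))$ for some $i,j\in\{0,\dots,N_k-1\}$. For $\alpha\in\Omega$ let $x_\alpha$ be the unique point of $\bigcap_k I_{(\alpha_0,\dots,\alpha_k)}$, and let $C:=\{x_\alpha:\alpha\in\Omega\}$ with the Euclidean metric. The map $\alpha\mapsto x_\alpha$ is injective. Let $\ell_\infty(C)=C\times C\times\cdots$, and for $i=1,\dots,4$ let $f_i:\ell_\infty(C)\to C$, $$f_i(x_{\alpha_0},x_{\alpha_1},\dots):=x_\gamma,\qquad \gamma:=\bigl(i,(\alpha^{(0)}_0,\dots,\alpha^{(0)}_{m_0-1}),(\alpha^{(1)}_0,\dots,\alpha^{(1)}_{m_1-1}),\dots\bigr),$$ where $\alpha_j^{(k)}$ is the $k$-th coordinate of $\alpha_j$ (coordinates are numbered from $0$). **Terminology.** Let $X$ be a metric space, and let $\mathbb K(X)$ be the space of its nonempty compact subsets with the Hausdorff metric. For bounded sequences put $d_{s,q}(x,y)=\sup_k q^k d(x_k,y_k)$. Let $L_{s,q}(f)$ be the Lipschitz constant of $f:\ell_\infty(X)\to X$ from $d_{s,q}$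 to $d$, and $L_{(s,q)}(\mathcal F)=\max_iL_{s,q}(f_i)$ for a finite family $\mathcal F=\{f_1,\dots,f_n\}$ of such maps. $\mathcal F$ is a GIFS$_\infty$ if $\overline{f_i(\prod_kK_k)}\in\mathbb K(X)$ for every $i$ and every bounded sequence $(K_k)$ in $\mathbb K(X)$. A set $A\in\mathbb K(X)$ is an attractor of $\mathcal F$ if $A=\bigcup_i\overline{f_i(A\times A\times\cdots)}$. A map $g:X^m\to X$ is a generalized weak contraction if $d(g(x),g(y))<\max_{j}d(x_j,y_j)$ whenever $x\ne y$. A set $A\in\mathbb K(X)$ is an attractor of a finite family of maps $g_1,\dots,g_r:X^m\to X$ if $A=\bigcup_ig_i(A^m)$. **Theorem.** For all $K,q\in(0,1)$ and every nondecreasing sequence $(m_k)$ of positive integers the choices above are possible, and for every such choice: (i) $\mathcal F=\{f_1,\dots,f_4\}$ is a GIFS$_\infty$ with $L_{(s,q)}(\mathcal F)<K$ (in particular, $L_{(s,q')}(\mathcal F)<1$ for some $q'\in(0,1)$), and $C$ is its unique attractor. (ii) Assume additionally that for every integer $k\ge1$ $$(1+m_0+m_0m_1+\dots+m_0\cdots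 m_{k-1})(k-1)-m_0\cdots m_k<-k .$$ Then there is a Borel probability measure $\mu$ on $C$ such that $\mu(g(C^m))=0$ for every integer $m\ge1$ and every generalized weak contraction $g:C^m\to C$. In particular, for no $m\ge 1$ is $C$ the attractor of a finite family of generalized weak contractions $C^m\to C$ (hence not of any GIFS on $C$, that is, a finite family of maps $g:C^m\to C$ with $\operatorname{Lip}(g)<1$ for the maximum metric). Moreover, nondecreasing sequences of positive integers satisfying the condition in (ii) exist. -/

import Mathlib

open Set
open scoped NNReal ENNReal

/-! ## Maps on bounded sequences, and generalized iterated function systems -/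

section General

/-- The `ℓ_∞`-sum of a metric space: all bounded sequences. -/
def LInfty (X : Type*) [MetricSpace X] : Type _ :=
  {x : ℕ → X // Bornology.IsBounded (Set.range x)}

/-- The constant sequence `(x, x, x, ...)`. -/
def LInfty.const {X : Type*} [MetricSpace X] (x : X) : LInfty X :=
  ⟨fun _ => x, by rw [Set.range_const]; exact Bornology.isBounded_singleton⟩

/-- `d_{s,q}(x, y) = sup_k q ^ k * d (x_k, y_k)` (a finite supremum when `0 < q ≤ 1`). -/
noncomputable def distSQ {X : Type*} [MetricSpace X] (q : ℝ) (x y : LInfty X) : ℝ :=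
  ⨆ k : ℕ, q ^ k * dist (x.1 k) (y.1 k)

/-- `L_{s,q}(f)`: the Lipschitz constant, possibly `∞`, of `f : ℓ_∞(X) → X` with respect to
`d_{s,q}` and the metric of `X`. -/
noncomputable def lipSQ {X : Type*} [MetricSpace X] (q : ℝ) (f : LInfty X → X) : ℝ≥0∞ :=
  ⨅ (L : ℝ≥0) (_ : ∀ x y : LInfty X, dist (f x) (f y) ≤ L * distSQ q x y), (L : ℝ≥0∞)

/-- `L_{(s,q)}(F) = max_i L_{s,q}(f_i)` for a finite family `F = {f_1, ..., f_n}`. -/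
noncomputable def lipFamilySQ {X : Type*} [MetricSpace X] {n : ℕ} (q : ℝ)
    (f : Fin n → LInfty X → X) : ℝ≥0∞ :=
  ⨆ i, lipSQ q (f i)

/-- The product `K_0 × K_1 × ⋯` of a bounded sequence of nonempty compact sets. The sequence is
bounded for the Hausdorff metric, so its union is bounded and every choice `x_k ∈ K_k` is a
bounded sequence. -/
def prodSet {X : Type*} [MetricSpace X] (K : LInfty (TopologicalSpace.NonemptyCompacts X)) :
    Set (LInfty X) :=
  {x | ∀ k, x.1 k ∈ K.1 k}

/-- Condition (C1): the closure of the image of each such product belongs to `𝕂(X)`. -/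
def CondC1 {X : Type*} [MetricSpace X] (f : LInfty X → X) : Prop :=
  ∀ K : LInfty (TopologicalSpace.NonemptyCompacts X),
    (closure (f '' prodSet K)).Nonempty ∧ IsCompact (closure (f '' prodSet K))

/-- A generalized iterated function system of infinite order. -/
def IsGIFSInfty {X : Type*} [MetricSpace X] {n : ℕ} (f : Fin n → LInfty X → X) : Prop :=
  ∀ i, CondC1 (f i)

/-- Condition (Q): `L_{(s,q)}(F) < 1` for some `q ∈ (0, 1)`. -/
def CondQ {X : Type*} [MetricSpace X] {n : ℕ} (f : Fin n → LInfty X → X) : Prop :=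
  ∃ q : ℝ, 0 < q ∧ q < 1 ∧ lipFamilySQ q f < 1

/-- The set `F(K_0, K_1, ...)`, the union of the closures of the sets `f_i (K_0 × K_1 × ⋯)`. -/
def gifsInftyImage {X : Type*} [MetricSpace X] {n : ℕ} (f : Fin n → LInfty X → X)
    (K : LInfty (TopologicalSpace.NonemptyCompacts X)) : Set X :=
  ⋃ i, closure (f i '' prodSet K)

/-- `A ∈ 𝕂(X)` is an attractor of `F` if `F(A, A, ...) = A`. -/
def IsGIFSInftyAttractor {X : Type*} [MetricSpace X] {n : ℕ} (f : Fin n → LInfty X → X)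
    (A : TopologicalSpace.NonemptyCompacts X) : Prop :=
  gifsInftyImage f (LInfty.const A) = (A : Set X)

/-- A generalized weak contraction `X ^ m → X`; the metric on `Fin m → X` is the maximum metric. -/
def IsGenWeakContraction {X : Type*} [MetricSpace X] {m : ℕ} (g : (Fin m → X) → X) : Prop :=
  ∀ x y : Fin m → X, x ≠ y → dist (g x) (g y) < dist x y

/-- `A` is an attractor of the GIFS `{f_1, ..., f_n}` of order `m`:
`A = f_1 (A × ⋯ × A) ∪ ⋯ ∪ f_n (A × ⋯ × A)`. -/
def IsGIFSAttractor {X : Type*} [MetricSpace X] {n m : ℕ} (f : Fin n → (Fin m → X) → X)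
    (A : TopologicalSpace.NonemptyCompacts X) : Prop :=
  ⋃ i, f i '' {x | ∀ j, x j ∈ A} = (A : Set X)

end General

/-! ## Codes -/

/-- The finite alphabets: `Ω_0` has four elements and `Ω_{k+1} = (Ω_k) ^ (m_k)`. -/
def Alphabet (m : ℕ → ℕ) : ℕ → Type
  | 0 => Fin 4
  | k + 1 => Fin (m k) → Alphabet m k

/-- The finite words `Ω_0 × ⋯ × Ω_k`. -/
def Word (m : ℕ → ℕ) : ℕ → Type
  | 0 => Alphabet m 0
  | k + 1 => Word m k × Alphabet m (k + 1)

/-- The infinite words `Ω_0 × Ω_1 × Ω_2 × ⋯`. -/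
def Code (m : ℕ → ℕ) : Type := ∀ k, Alphabet m k

/-- The one-letter word `(i)`. -/
def Word.single {m : ℕ → ℕ} (i : Fin 4) : Word m 0 := i

/-- The word `α` followed by the letter `β`. -/
def Word.snoc {m : ℕ → ℕ} {k : ℕ} (α : Word m k) (β : Alphabet m (k + 1)) : Word m (k + 1) :=
  (α, β)

/-- The beginning `(α_0, ..., α_k)` of an infinite word. -/
def Code.trunc {m : ℕ → ℕ} (α : Code m) : (k : ℕ) → Word m k
  | 0 => α 0
  | k + 1 => (Code.trunc α k).snoc (α (k + 1))

/-- The code whose first letter is `i` and whose letter in position `k + 1` is the tuple of the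
letters in position `k` of `α_0, ..., α_{m_k - 1}`. -/
def Code.merge {m : ℕ → ℕ} (i : Fin 4) (α : ℕ → Code m) : Code m
  | 0 => i
  | k + 1 => fun j : Fin (m k) => α j k

/-! ## The squares and the Cantor-type set -/

/-- The Euclidean plane. -/
abbrev Plane : Type := EuclideanSpace ℝ (Fin 2)

/-- The closed square with lower left corner `c` and side `s`. -/
def closedSquare (c : ℝ × ℝ) (s : ℝ) : Set Plane :=
  {z | z 0 ∈ Icc c.1 (c.1 + s) ∧ z 1 ∈ Icc c.2 (c.2 + s)}

/-- `√(4 ^ (m_0 ⋯ m_k)) = 2 ^ (m_0 ⋯ m_k)`, the number of squares of level `k + 1` along a side of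
a square of level `k`. -/
def gridSize (m : ℕ → ℕ) (k : ℕ) : ℕ := 2 ^ ∏ i ∈ Finset.range (k + 1), m i

/-- The choices made in the construction of the Cantor-type set: side lengths `p_k`, gaps `a_k`,
and a square `I_α` of side `p_k`, given by its lower left corner, for each word
`α ∈ Ω_0 × ⋯ × Ω_k`. -/
structure SquareConstruction (K q : ℝ) (m : ℕ → ℕ) where
  p : ℕ → ℝ
  a : ℕ → ℝ
  p_pos : ∀ k, 0 < p k
  a_pos : ∀ k, 0 < a k
  p_decreasing : StrictAnti p
  a_decreasing : StrictAnti a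
  sides_zero : 2 * p 0 + a 0 = 1
  sides_succ : ∀ k,
    (gridSize m k : ℝ) * p (k + 1) + ((gridSize m k : ℝ) - 1) * a (k + 1) = p k
  ratio_lt : ∀ k, p k / a k < K * q ^ m k / √2
  /-- The lower left corner of `I_α`. -/
  corner : ∀ k, Word m k → ℝ × ℝ
  /-- The four squares of level `0` sit at the corners of the unit square. -/
  corner_zero : ∀ i : Fin 4, corner 0 (Word.single i) =
    ![(0, 0), (p 0 + a 0, 0), (0, p 0 + a 0), (p 0 + a 0, p 0 + a 0)] i
  /-- The squares of level `k + 1` inside `I_α` lie on the regular grid of step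
  `p_{k+1} + a_{k+1}`. -/
  corner_succ : ∀ (k : ℕ) (α : Word m k) (β : Alphabet m (k + 1)),
    ∃ i j : ℕ, i < gridSize m k ∧ j < gridSize m k ∧
      corner (k + 1) (α.snoc β) =
        ((corner k α).1 + i * (p (k + 1) + a (k + 1)),
          (corner k α).2 + j * (p (k + 1) + a (k + 1)))
  disjoint_succ : ∀ (k : ℕ) (α : Word m k) (β β' : Alphabet m (k + 1)), β ≠ β' →
    Disjoint (closedSquare (corner (k + 1) (α.snoc β)) (p (k + 1)))
      (closedSquare (corner (k + 1) (α.snoc β')) (p (k + 1)))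

namespace SquareConstruction

variable {K q : ℝ} {m : ℕ → ℕ} (S : SquareConstruction K q m)

/-- The square `I_α`. -/
def square {k : ℕ} (α : Word m k) : Set Plane := closedSquare (S.corner k α) (S.p k)

theorem corner_bounds (k : ℕ) (α : Word m k) (β : Alphabet m (k + 1)) :
    ((S.corner k α).1 ≤ (S.corner (k + 1) (α.snoc β)).1 ∧
      (S.corner (k + 1) (α.snoc β)).1 + S.p (k + 1) ≤ (S.corner k α).1 + S.p k) ∧
    ((S.corner k α).2 ≤ (S.corner (k + 1) (α.snoc β)).2 ∧
      (S.corner (k + 1) (α.snoc β)).2 + S.p (k + 1) ≤ (S.corner k α).2 + S.p k) := by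
  obtain ⟨i, j, hi, hj, h⟩ := S.corner_succ k α β
  have hp := S.p_pos (k + 1)
  have ha := S.a_pos (k + 1)
  have key : ∀ i : ℕ, i < gridSize m k →
      0 ≤ (i : ℝ) * (S.p (k + 1) + S.a (k + 1)) ∧
      (i : ℝ) * (S.p (k + 1) + S.a (k + 1)) + S.p (k + 1) ≤ S.p k := by
    intro i hi
    refine ⟨by positivity, ?_⟩
    have hi' : (i : ℝ) ≤ (gridSize m k : ℝ) - 1 := by
      have : (i : ℝ) + 1 ≤ (gridSize m k : ℝ) := by exact_mod_cast hi
      linarith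
    have h1 := mul_le_mul_of_nonneg_right hi' (add_pos hp ha).le
    have h2 := S.sides_succ k
    linarith
  rw [h]
  have h1 := key i hi
  have h2 := key j hj
  refine ⟨⟨?_, ?_⟩, ?_, ?_⟩ <;> dsimp only <;> linarith

theorem p_tendsto : Filter.Tendsto S.p Filter.atTop (nhds 0) := by
  have hbound : ∀ k, S.p k ≤ S.p 0 * (1 / 2) ^ k := by
    intro k
    induction k with
    | zero => simp
    | succ k ih =>
      have h := S.sides_succ k
      have hp := S.p_pos (k + 1)
      have hq : 0 < S.p (k + 1) / S.a (k + 1) := div_pos hp (S.a_pos (k + 1))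
      have ha := S.a_pos (k + 1)
      have hN : (1 : ℝ) ≤ gridSize m k := by
        have : 1 ≤ gridSize m k := Nat.one_le_two_pow
        exact_mod_cast this
      rcases eq_or_lt_of_le hN with h1 | h1
      · -- a one-cell grid contradicts the strict decrease of the side lengths
        rw [← h1] at h
        have := S.p_decreasing (Nat.lt_succ_self k)
        simp only [Nat.succ_eq_add_one] at this
        linarith
      · have h2 : (2 : ℝ) ≤ gridSize m k := by
          have : 1 < gridSize m k := by exact_mod_cast h1
          exact_mod_cast this
        have h3 := mul_le_mul_of_nonneg_right h2 hp.le
        have h4 : 0 ≤ ((gridSize m k : ℝ) - 1) * S.a (k + 1) :=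
          mul_nonneg (by linarith) ha.le
        rw [pow_succ]
        linarith
  have hlim : Filter.Tendsto (fun k : ℕ => S.p 0 * (1 / 2 : ℝ) ^ k) Filter.atTop (nhds 0) := by
    simpa using (tendsto_pow_atTop_nhds_zero_of_lt_one (r := (1 / 2 : ℝ)) (by norm_num)
      (by norm_num)).const_mul (S.p 0)
  exact squeeze_zero (fun k => (S.p_pos k).le) hbound hlim

/-- The squares `I_{(α_0, ..., α_k)}` shrink to one point. -/
theorem existsUnique_point (α : Code m) : ∃! x : Plane, x ∈ ⋂ k, S.square (α.trunc k) := by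
  have h1 : Antitone fun k => Icc (S.corner k (α.trunc k)).1
      ((S.corner k (α.trunc k)).1 + S.p k) :=
    antitone_nat_of_succ_le fun k => Icc_subset_Icc
      (S.corner_bounds k (α.trunc k) (α (k + 1))).1.1
      (S.corner_bounds k (α.trunc k) (α (k + 1))).1.2
  have h2 : Antitone fun k => Icc (S.corner k (α.trunc k)).2
      ((S.corner k (α.trunc k)).2 + S.p k) :=
    antitone_nat_of_succ_le fun k => Icc_subset_Icc
      (S.corner_bounds k (α.trunc k) (α (k + 1))).2.1
      (S.corner_bounds k (α.trunc k) (α (k + 1))).2.2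
  have e1 := ciSup_mem_iInter_Icc_of_antitone_Icc h1
    fun k => le_add_of_nonneg_right (S.p_pos k).le
  have e2 := ciSup_mem_iInter_Icc_of_antitone_Icc h2
    fun k => le_add_of_nonneg_right (S.p_pos k).le
  rw [mem_iInter] at e1 e2
  refine ⟨!₂[_, _], mem_iInter.2 fun k => ⟨e1 k, e2 k⟩, ?_⟩
  have aux : ∀ (c : ℕ → ℝ) (u v : ℝ), (∀ k, u ∈ Icc (c k) (c k + S.p k)) →
      (∀ k, v ∈ Icc (c k) (c k + S.p k)) → u = v := by
    intro c u v hu hv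
    have h : |u - v| ≤ 0 := ge_of_tendsto' S.p_tendsto fun k => by
      have := hu k
      have := hv k
      simp only [mem_Icc] at *
      rw [abs_le]
      constructor <;> linarith
    exact sub_eq_zero.1 (abs_nonpos_iff.1 h)
  intro y hy
  rw [mem_iInter] at hy
  ext i
  fin_cases i
  · exact aux _ _ _ (fun k => (hy k).1) e1
  · exact aux _ _ _ (fun k => (hy k).2) e2

/-- The point `x_α`, the unique element of `⋂_k I_{(α_0, ..., α_k)}`. -/
noncomputable def point (α : Code m) : Plane := (S.existsUnique_point α).exists.choose

theorem point_mem (α : Code m) (k : ℕ) : S.point α ∈ S.square (α.trunc k) :=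
  mem_iInter.1 (S.existsUnique_point α).exists.choose_spec k

theorem point_injective : Function.Injective S.point := by
  intro α β h
  by_contra hne
  have hex : ∃ k, α k ≠ β k := by
    by_contra hcon
    push Not at hcon
    exact hne (funext hcon)
  classical
  let k := Nat.find hex
  have hk : α k ≠ β k := Nat.find_spec hex
  have hlt : ∀ j, j < k → α j = β j := fun j hj => not_not.1 (Nat.find_min hex hj)
  clear_value k
  cases k with
  | zero =>
    have hα := S.point_mem α 0
    have hβ := S.point_mem β 0
    rw [← h] at hβ
    have key : ∀ i j : Fin 4, i ≠ j → S.point α ∈ S.square (Word.single i : Word m 0) →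
        S.point α ∉ S.square (Word.single j : Word m 0) := by
      intro i j hij hi hj
      have hp := S.p_pos 0
      have ha := S.a_pos 0
      simp only [square, closedSquare, S.corner_zero, mem_ofPred_eq, mem_Icc] at hi hj
      fin_cases i <;> fin_cases j <;> simp at hij hi hj <;> linarith [hi.1.1, hi.1.2, hi.2.1,
        hi.2.2, hj.1.1, hj.1.2, hj.2.1, hj.2.2]
    exact key (α 0) (β 0) hk hα hβ
  | succ k =>
    have htr : ∀ j, j ≤ k → α.trunc j = β.trunc j := by
      intro j
      induction j with
      | zero => intro hj; exact hlt 0 (Nat.succ_pos k)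
      | succ j ih =>
        intro hj
        simp only [Code.trunc]
        rw [ih (by omega), hlt (j + 1) (by omega)]
    have hα := S.point_mem α (k + 1)
    have hβ := S.point_mem β (k + 1)
    rw [← h] at hβ
    simp only [Code.trunc] at hα hβ
    rw [← htr k le_rfl] at hβ
    exact disjoint_left.1 (S.disjoint_succ k (α.trunc k) _ _ hk) hα hβ

/-- The Cantor-type set `C = {x_α}`. -/
def cantorSet : Set Plane := Set.range S.point

/-- The bijection `α ↦ x_α` between codes and points of `C`. -/
noncomputable def codeEquiv : Code m ≃ S.cantorSet := Equiv.ofInjective S.point S.point_injective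

/-- The map `f_i : ℓ_∞(C) → C` with
`f_i (x_{α_0}, x_{α_1}, ...) = x_α`, where `α` is the merge of `i` and `(α_0, α_1, ...)`. -/
noncomputable def gifsMap (i : Fin 4) (y : LInfty S.cantorSet) : S.cantorSet :=
  S.codeEquiv (Code.merge i fun j => S.codeEquiv.symm (y.1 j))

end SquareConstruction

/-- The growth condition on `(m_k)`: for each `k ≥ 1`,
`(1 + m_0 + m_0 m_1 + ⋯ + m_0 ⋯ m_{k-1}) (k - 1) - m_0 ⋯ m_k < -k`. -/
def GrowsFast (m : ℕ → ℕ) : Prop :=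
  ∀ k : ℕ, 1 ≤ k →
    (∑ j ∈ Finset.range (k + 1), ∏ i ∈ Finset.range j, (m i : ℤ)) * ((k : ℤ) - 1)
      - ∏ i ∈ Finset.range (k + 1), (m i : ℤ) < -(k : ℤ)

/-! ## Squares in the plane -/

/-! The set `C` has two scales at each level: a square of level `k` has diameter `√2 * p k`, while
points whose codes differ in position `k` are at least `a k` apart (`gap_le_dist`). The ratio
condition makes the first number smaller than `K * q ^ m k` times the second (`diam_lt`).

Part (i): if two merged codes first differ in position `k + 1`, the images share a square of level
`k`, and for some `j < m k` the `j`-th arguments differ in position `k`, hence are `a k` apart.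
Since `q ^ m k ≤ q * q ^ j`, this gives the Lipschitz constant `K * q` (`dist_gifsMap_le`). Every
code is a merge, so `C` is an attractor. The codes of any attractor are stable under merging, hence
dense (`Code.exists_agree_of_merge_mem`), and an attractor is closed, so it is all of `C`.

Part (ii): inside a square of level `k` the set `C` is connected by jumps of length at most `a (k +
1)` (`chain_of_mem_parent`). A generalized weak contraction makes the jumps strictly shorter, so
their images cannot leave a square of level `k + 1` (`initial_succ_eq_of_isGenWeakContraction`). Let
`A` be the sum of the `m_0 ⋯ m_{j-1}` over `j ≤ k`, and `B = m_0 ⋯ m_k`. There are `4 ^ (A * n)`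
products of `n` squares of level `k`, and the uniform measure gives each square of level `k + 1`
mass `4 ^ -(A + B)`. So the range has measure at most `4 ^ (A * n - A - B)`, which the growth
condition bounds by `4 ^ -k` once `k ≥ n` (`uniform_range_eq_zero`). -/

theorem corner_mem_closedSquare (c : ℝ × ℝ) {s : ℝ} (hs : 0 ≤ s) :
    (!₂[c.1, c.2] : Plane) ∈ closedSquare c s := by
  simp [closedSquare, hs]

theorem dist_le_of_mem_closedSquare {c : ℝ × ℝ} {s : ℝ} {z w : Plane}
    (hz : z ∈ closedSquare c s) (hw : w ∈ closedSquare c s) : dist z w ≤ √2 * s := by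
  obtain ⟨⟨h1, h2⟩, h3, h4⟩ := hz
  obtain ⟨⟨k1, k2⟩, k3, k4⟩ := hw
  have hs : 0 ≤ s := by linarith
  rw [EuclideanSpace.dist_eq, Fin.sum_univ_two, Real.dist_eq, Real.dist_eq, sq_abs, sq_abs]
  refine Real.sqrt_le_iff.2 ⟨by positivity, ?_⟩
  rw [mul_pow, Real.sq_sqrt zero_le_two]
  have e1 : (z 0 - w 0) ^ 2 ≤ s ^ 2 := sq_le_sq' (by linarith) (by linarith)
  have e2 : (z 1 - w 1) ^ 2 ≤ s ^ 2 := sq_le_sq' (by linarith) (by linarith)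
  linarith

theorem abs_coord_sub_le_dist (z w : Plane) (i : Fin 2) : |z i - w i| ≤ dist z w := by
  have := PiLp.norm_apply_le (z - w) i
  rwa [← dist_eq_norm] at this

theorem le_dist_of_corner_gap {c c' : ℝ × ℝ} {s a : ℝ} {z w : Plane}
    (hz : z ∈ closedSquare c s) (hw : w ∈ closedSquare c' s)
    (h : s + a ≤ |c.1 - c'.1| ∨ s + a ≤ |c.2 - c'.2|) : a ≤ dist z w := by
  obtain ⟨⟨h1, h2⟩, h3, h4⟩ := hz
  obtain ⟨⟨k1, k2⟩, k3, k4⟩ := hw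
  rcases h with h | h
  · refine le_trans ?_ (abs_coord_sub_le_dist z w 0)
    rcases le_abs.1 h with h | h
    · exact le_abs.2 (Or.inl (by linarith))
    · exact le_abs.2 (Or.inr (by linarith))
  · refine le_trans ?_ (abs_coord_sub_le_dist z w 1)
    rcases le_abs.1 h with h | h
    · exact le_abs.2 (Or.inl (by linarith))
    · exact le_abs.2 (Or.inr (by linarith))

theorem le_abs_sub_natCast_mul {i j : ℕ} (h : i ≠ j) {t : ℝ} (ht : 0 ≤ t) (u : ℝ) :
    t ≤ |(u + i * t) - (u + j * t)| := by
  have e : (u + i * t) - (u + j * t) = (((i : ℤ) - (j : ℤ) : ℤ) : ℝ) * t := by push_cast; ring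
  rw [e, abs_mul, abs_of_nonneg ht]
  have h1 : (1 : ℤ) ≤ |(i : ℤ) - j| := Int.one_le_abs (by omega)
  have h2 : (1 : ℝ) ≤ |(((i : ℤ) - (j : ℤ) : ℤ) : ℝ)| := by exact_mod_cast h1
  nlinarith

/-! ## Alphabets and words -/

instance Alphabet.instFinite (m : ℕ → ℕ) : ∀ k, Finite (Alphabet m k)
  | 0 => inferInstanceAs (Finite (Fin 4))
  | k + 1 =>
    have := Alphabet.instFinite m k
    inferInstanceAs (Finite (Fin (m k) → Alphabet m k))

instance Alphabet.instNonempty (m : ℕ → ℕ) : ∀ k, Nonempty (Alphabet m k)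
  | 0 => inferInstanceAs (Nonempty (Fin 4))
  | k + 1 =>
    have := Alphabet.instNonempty m k
    inferInstanceAs (Nonempty (Fin (m k) → Alphabet m k))

instance Code.instNonempty (m : ℕ → ℕ) : Nonempty (Code m) :=
  inferInstanceAs (Nonempty (∀ k, Alphabet m k))

theorem Alphabet.card (m : ℕ → ℕ) (k : ℕ) :
    Nat.card (Alphabet m k) = 4 ^ ∏ i ∈ Finset.range k, m i := by
  induction k with
  | zero => simp [Alphabet]
  | succ k ih =>
    have : Nat.card (Alphabet m (k + 1)) = Nat.card (Fin (m k) → Alphabet m k) := rfl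
    rw [this, Nat.card_fun, ih, Finset.prod_range_succ, pow_mul, Nat.card_fin]

theorem Alphabet.card_succ (m : ℕ → ℕ) (k : ℕ) :
    Nat.card (Alphabet m (k + 1)) = gridSize m k * gridSize m k := by
  rw [Alphabet.card, gridSize, ← mul_pow]; norm_num

theorem Code.trunc_congr {m : ℕ → ℕ} {α β : Code m} {k : ℕ} (h : ∀ j ≤ k, α j = β j) :
    α.trunc k = β.trunc k := by
  induction k with
  | zero => exact h 0 le_rfl
  | succ k ih => rw [trunc, trunc, ih fun j hj => h j (by omega), h (k + 1) le_rfl]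

theorem Code.exists_trunc_eq {m : ℕ → ℕ} (k : ℕ) (w : Word m k) : ∃ α : Code m, α.trunc k = w := by
  classical
  have hupd : ∀ (α : Code m) (k : ℕ) (b : Alphabet m k),
      ∃ β : Code m, β k = b ∧ ∀ j, j ≠ k → β j = α j := fun α k b =>
    ⟨fun j => Function.update (β := Alphabet m) α k b j,
      Function.update_self (β := Alphabet m) k b α,
      fun j hj => Function.update_of_ne (β := Alphabet m) hj b α⟩
  induction k with
  | zero =>
    obtain ⟨α⟩ := Code.instNonempty m
    obtain ⟨β, hβ, -⟩ := hupd α 0 w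
    exact ⟨β, hβ⟩
  | succ k ih =>
    obtain ⟨α, hα⟩ := ih w.1
    obtain ⟨β, hβ, hne⟩ := hupd α (k + 1) w.2
    refine ⟨β, ?_⟩
    rw [trunc, Code.trunc_congr (β := α) fun j hj => hne j (by omega), hα, hβ]
    rfl

theorem one_le_gridSize (m : ℕ → ℕ) (k : ℕ) : 1 ≤ gridSize m k := Nat.one_le_two_pow

theorem two_le_gridSize {m : ℕ → ℕ} (hm : ∀ k, 0 < m k) (k : ℕ) : 2 ≤ gridSize m k := by
  have : 1 ≤ ∏ i ∈ Finset.range (k + 1), m i := Finset.prod_pos fun i _ => hm i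
  exact (Nat.pow_le_pow_right two_pos this)

/-! ## Existence of the construction -/

/-- Side lengths obtained by splitting each side in the proportion `e k : 1` between squares and
gaps. -/
noncomputable def splitSide (e : ℕ → ℝ) (N : ℕ → ℝ) : ℕ → ℝ
  | 0 => e 0 / ((1 + e 0) * 2)
  | k + 1 => e (k + 1) * splitSide e N k / ((1 + e (k + 1)) * N k)

/-- The gaps that go with `splitSide`. -/
noncomputable def splitGap (e : ℕ → ℝ) (N : ℕ → ℝ) : ℕ → ℝ
  | 0 => 1 / (1 + e 0)
  | k + 1 => splitSide e N k / ((1 + e (k + 1)) * (N k - 1))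

/-- Lower left corners prescribed by an enumeration of each grid. -/
noncomputable def gridCorner (m : ℕ → ℕ) (p a : ℕ → ℝ)
    (φ : ∀ k, Alphabet m (k + 1) → Fin (gridSize m k) × Fin (gridSize m k)) :
    ∀ k, Word m k → ℝ × ℝ
  | 0 => ![(0, 0), (p 0 + a 0, 0), (0, p 0 + a 0), (p 0 + a 0, p 0 + a 0)]
  | k + 1 => fun w =>
    ((gridCorner m p a φ k w.1).1 + (φ k w.2).1 * (p (k + 1) + a (k + 1)),
      (gridCorner m p a φ k w.1).2 + (φ k w.2).2 * (p (k + 1) + a (k + 1)))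

section Split

variable {e N : ℕ → ℝ}

theorem splitSide_pos (he : ∀ k, 0 < e k) (hN : ∀ k, 2 ≤ N k) (k : ℕ) : 0 < splitSide e N k := by
  induction k with
  | zero => have := he 0; rw [splitSide]; positivity
  | succ k ih => have := he (k + 1); have := hN k; rw [splitSide]; positivity

theorem splitGap_pos (he : ∀ k, 0 < e k) (hN : ∀ k, 2 ≤ N k) (k : ℕ) : 0 < splitGap e N k := by
  cases k with
  | zero => have := he 0; rw [splitGap]; positivity
  | succ k =>
    have := he (k + 1)
    have : 0 < N k - 1 := by linarith [hN k]
    have := splitSide_pos he hN k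
    rw [splitGap]; positivity

/-- The squares along a side and the gaps along it have total lengths in the proportion `e k : 1`,
but there is one gap fewer than squares, so the individual ratio is strictly below `e k`. -/
theorem splitSide_lt (he : ∀ k, 0 < e k) (hN : ∀ k, 2 ≤ N k) (k : ℕ) :
    splitSide e N k < e k * splitGap e N k := by
  cases k with
  | zero =>
    have := he 0
    rw [splitSide, splitGap, mul_one_div]
    exact div_lt_div_of_pos_left this (by positivity) (by linarith)
  | succ k =>
    have := he (k + 1)
    have h1 : 0 < N k - 1 := by linarith [hN k]
    have := splitSide_pos he hN k
    rw [splitSide, splitGap, ← mul_div_assoc]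
    exact div_lt_div_of_pos_left (by positivity) (by positivity)
      (mul_lt_mul_of_pos_left (by linarith) (by positivity))

theorem splitSide_succ (he : ∀ k, 0 < e k) (hN : ∀ k, 2 ≤ N k) (k : ℕ) :
    N k * splitSide e N (k + 1) + (N k - 1) * splitGap e N (k + 1) = splitSide e N k := by
  have h0 := he (k + 1)
  have h1 : N k - 1 ≠ 0 := by linarith [hN k]
  have h2 : N k ≠ 0 := by linarith [hN k]
  have h3 : 1 + e (k + 1) ≠ 0 := by linarith
  rw [splitSide, splitGap]
  field_simp
  ring

theorem splitSide_strictAnti (he : ∀ k, 0 < e k) (hN : ∀ k, 2 ≤ N k) :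
    StrictAnti (splitSide e N) := by
  refine strictAnti_nat_of_succ_lt fun k => ?_
  have h := splitSide_succ he hN k
  have h1 := splitSide_pos he hN (k + 1)
  have h2 := splitGap_pos he hN (k + 1)
  nlinarith [hN k]

theorem splitGap_strictAnti (he : ∀ k, 0 < e k) (he1 : ∀ k, e k ≤ 1) (hN : ∀ k, 2 ≤ N k) :
    StrictAnti (splitGap e N) := by
  refine strictAnti_nat_of_succ_lt fun k => ?_
  have h := splitSide_succ he hN k
  have h1 := splitSide_pos he hN (k + 1)
  have h2 := splitGap_pos he hN (k + 1)
  have h3 := splitSide_lt he hN k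
  have h4 := splitGap_pos he hN k
  have h5 := he1 k
  -- With `N`, `a`, `p` for the grid size, gap and side: `a_{k+1} ≤ (N_k - 1) a_{k+1} < p_k < e_k
  -- a_k ≤ a_k`.
  nlinarith [hN k]

end Split

theorem SquareConstruction.nonempty {K q : ℝ} {m : ℕ → ℕ} (hK : 0 < K) (hK1 : K < 1) (hq : 0 < q)
    (hq1 : q < 1) (hm : ∀ k, 0 < m k) : Nonempty (SquareConstruction K q m) := by
  classical
  set e : ℕ → ℝ := fun k => K * q ^ m k / √2 with he_def
  have he : ∀ k, 0 < e k := fun k => by simp only [e]; positivity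
  have he1 : ∀ k, e k ≤ 1 := fun k => by
    have h1 : q ^ m k ≤ 1 := pow_le_one₀ hq.le hq1.le
    have h2 : (1 : ℝ) ≤ √2 := Real.one_le_sqrt.2 one_le_two
    rw [he_def, div_le_one (by positivity)]
    exact (mul_le_one₀ hK1.le (by positivity) h1).trans h2
  set N : ℕ → ℝ := fun k => gridSize m k with hN_def
  have hN : ∀ k, 2 ≤ N k := fun k => by
    simp only [N]; exact_mod_cast two_le_gridSize hm k
  -- There are as many letters as grid cells, so any bijection between them places the squares.
  have hφ : ∀ k, Nonempty (Alphabet m (k + 1) ≃ Fin (gridSize m k) × Fin (gridSize m k)) := by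
    intro k
    refine (Finite.card_eq.1 ?_)
    rw [Alphabet.card_succ, Nat.card_prod, Nat.card_fin]
  let φ := fun k => (hφ k).some
  have hp := splitSide_pos he hN
  have ha := splitGap_pos he hN
  refine ⟨⟨splitSide e N, splitGap e N, hp, ha, splitSide_strictAnti he hN,
    splitGap_strictAnti he he1 hN, ?_, splitSide_succ he hN, fun k => ?_,
    gridCorner m _ _ fun k => φ k, fun i => rfl, fun k α β => ?_, fun k α β β' hne => ?_⟩⟩
  · have := he 0
    rw [splitSide, splitGap]
    field_simp
    ring
  · rw [div_lt_iff₀ (ha k)]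
    exact splitSide_lt he hN k
  · exact ⟨(φ k β).1, (φ k β).2, (φ k β).1.2, (φ k β).2.2, rfl⟩
  · refine disjoint_left.2 fun z hz hz' => ?_
    have hsum : 0 ≤ splitSide e N (k + 1) + splitGap e N (k + 1) :=
      (add_pos (hp (k + 1)) (ha (k + 1))).le
    have hgap := le_dist_of_corner_gap (a := splitGap e N (k + 1)) hz hz' (by
      have h : (φ k β).1 ≠ (φ k β').1 ∨ (φ k β).2 ≠ (φ k β').2 := by
        by_contra! hcon
        exact hne ((φ k).injective (Prod.ext hcon.1 hcon.2))
      rcases h with h | h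
      · exact Or.inl (le_abs_sub_natCast_mul (fun h' => h (Fin.ext h')) hsum _)
      · exact Or.inr (le_abs_sub_natCast_mul (fun h' => h (Fin.ext h')) hsum _))
    rw [dist_self] at hgap
    exact absurd (ha (k + 1)) (not_lt.2 hgap)

theorem exists_growsFast : ∃ m : ℕ → ℕ, Monotone m ∧ (∀ k, 0 < m k) ∧ GrowsFast m := by
  -- With `P j = m_0 ⋯ m_{j-1}`, the sum is at most `(k + 1) * P k`, so the left side is at most `P
  -- k * ((k ^ 2 - 1) - (k ^ 2 + k + 1)) = -(k + 2) * P k`, and `P k ≥ 1`.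
  set m : ℕ → ℕ := fun k => k ^ 2 + k + 1 with hm
  refine ⟨m, fun i j h => by simp only [hm]; gcongr, fun k => by positivity, fun k hk => ?_⟩
  set P : ℕ → ℤ := fun j => ∏ i ∈ Finset.range j, (m i : ℤ)
  have h1 : ∀ i, (1 : ℤ) ≤ m i := fun i => by simp only [hm]; push_cast; nlinarith
  have hP1 : ∀ j, 1 ≤ P j := fun j => Int.add_one_le_of_lt
    (Finset.prod_pos fun i _ => by linarith [h1 i])
  have hP : Monotone P := monotone_nat_of_le_succ fun j => by
    simp only [P, Finset.prod_range_succ]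
    have := h1 j
    have : 1 ≤ P j := hP1 j
    simp only [P] at this
    nlinarith
  have hsum : ∑ j ∈ Finset.range (k + 1), P j ≤ (k + 1) * P k := by
    have := Finset.sum_le_card_nsmul (Finset.range (k + 1)) P (P k)
      fun j hj => hP (by simpa [Nat.lt_succ_iff] using hj)
    simpa using this
  have hsucc : P (k + 1) = P k * ((k : ℤ) ^ 2 + k + 1) := by
    simp only [P, Finset.prod_range_succ, hm]
    push_cast
    rfl
  change (∑ j ∈ Finset.range (k + 1), P j) * ((k : ℤ) - 1) - P (k + 1) < -(k : ℤ)
  rw [hsucc]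
  have hk' : (0 : ℤ) ≤ (k : ℤ) - 1 := by omega
  have := mul_le_mul_of_nonneg_right hsum hk'
  nlinarith [hP1 k]

/-! ### Topology of the code space and density of merge-stable sets. -/

instance Alphabet.instTopologicalSpace (m : ℕ → ℕ) (k : ℕ) : TopologicalSpace (Alphabet m k) := ⊥

instance Alphabet.instDiscreteTopology (m : ℕ → ℕ) (k : ℕ) : DiscreteTopology (Alphabet m k) :=
  ⟨rfl⟩

instance Code.instTopologicalSpace (m : ℕ → ℕ) : TopologicalSpace (Code m) :=
  inferInstanceAs (TopologicalSpace (∀ k, Alphabet m k))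

instance Code.instCompactSpace (m : ℕ → ℕ) : CompactSpace (Code m) :=
  inferInstanceAs (CompactSpace (∀ k, Alphabet m k))

theorem Code.eventually_agree {m : ℕ → ℕ} (α : Code m) (k : ℕ) :
    ∀ᶠ β in nhds α, ∀ j ≤ k, β j = α j := by
  have h : ∀ j, ∀ᶠ β : Code m in nhds α, β j = α j := fun j => by
    have hc : Continuous fun β : Code m => β j := continuous_apply (A := Alphabet m) j
    exact hc.continuousAt.eventually (p := fun b => b = α j) (by rw [nhds_discrete]; exact rfl)
  exact (Filter.eventually_all_finite (finite_Iic k)).2 fun j _ => h j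

/-- A nonempty set of codes that is stable under merging contains every initial segment. -/
theorem Code.exists_agree_of_merge_mem {m : ℕ → ℕ} {s : Set (Code m)} (hs : s.Nonempty)
    (h : ∀ i (α : ℕ → Code m), (∀ j, α j ∈ s) → Code.merge i α ∈ s) (k : ℕ) (γ : Code m) :
    ∃ β ∈ s, ∀ j ≤ k, β j = γ j := by
  induction k generalizing γ with
  | zero =>
    obtain ⟨α, hα⟩ := hs
    refine ⟨Code.merge (γ 0) fun _ => α, h _ _ fun _ => hα, fun j hj => ?_⟩
    obtain rfl := Nat.le_zero.1 hj
    rfl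
  | succ k ih =>
    classical
    obtain ⟨δ⟩ := Code.instNonempty m
    -- Undo the merge: entry `j` of the tuple `γ (l + 1)` is the letter wanted in position `l` of
    -- argument `j`. For `j ≥ m l` that letter is never read, and `δ` is a filler.
    choose β hβ hβγ using fun j : ℕ => ih fun l => if hj : j < m l then γ (l + 1) ⟨j, hj⟩ else δ l
    refine ⟨Code.merge (γ 0) β, h _ _ hβ, fun l hl => ?_⟩
    cases l with
    | zero => rfl
    | succ l =>
      refine funext fun j : Fin (m l) => ?_
      have := hβγ j l (by omega)
      simp only [Fin.is_lt, dif_pos] at this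
      exact this

/-! ### Separation and diameter estimates for points of the Cantor-type set. -/

namespace SquareConstruction

variable {K q : ℝ} {m : ℕ → ℕ} (S : SquareConstruction K q m)

theorem square_subset {α : Code m} {j k : ℕ} (h : j ≤ k) :
    S.square (α.trunc k) ⊆ S.square (α.trunc j) := by
  induction k, h using Nat.le_induction with
  | base => exact subset_rfl
  | succ k _ ih =>
    refine Subset.trans (fun z hz => ?_) ih
    obtain ⟨⟨h1, h2⟩, h3, h4⟩ := S.corner_bounds k (α.trunc k) (α (k + 1))
    obtain ⟨⟨z1, z2⟩, z3, z4⟩ := hz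
    exact ⟨⟨h1.trans z1, z2.trans h2⟩, h3.trans z3, z4.trans h4⟩

theorem corner_gap_zero {i j : Fin 4} (h : i ≠ j) :
    S.p 0 + S.a 0 ≤ |(S.corner 0 (Word.single i)).1 - (S.corner 0 (Word.single j)).1| ∨
    S.p 0 + S.a 0 ≤ |(S.corner 0 (Word.single i)).2 - (S.corner 0 (Word.single j)).2| := by
  have hs := add_pos (S.p_pos 0) (S.a_pos 0)
  rw [S.corner_zero, S.corner_zero]
  have hs' : |-S.a 0 + -S.p 0| = S.p 0 + S.a 0 := by
    rw [← abs_of_pos hs, ← abs_neg]; congr 1; ring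
  fin_cases i <;> fin_cases j <;> simp [abs_of_pos hs, hs'] at h ⊢

theorem corner_gap_succ {k : ℕ} {w : Word m k} {b b' : Alphabet m (k + 1)} (h : b ≠ b') :
    S.p (k + 1) + S.a (k + 1) ≤
      |(S.corner (k + 1) (w.snoc b)).1 - (S.corner (k + 1) (w.snoc b')).1| ∨
    S.p (k + 1) + S.a (k + 1) ≤
      |(S.corner (k + 1) (w.snoc b)).2 - (S.corner (k + 1) (w.snoc b')).2| := by
  have hs := (add_pos (S.p_pos (k + 1)) (S.a_pos (k + 1))).le
  have hdisj := S.disjoint_succ k w b b' h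
  obtain ⟨i, j, -, -, e⟩ := S.corner_succ k w b
  obtain ⟨i', j', -, -, e'⟩ := S.corner_succ k w b'
  -- Two squares in the same grid cell would share their corner, against disjointness.
  have hij : i ≠ i' ∨ j ≠ j' := by
    by_contra! hcon
    rw [hcon.1, hcon.2, ← e'] at e
    rw [e] at hdisj
    have hmem := corner_mem_closedSquare (S.corner (k + 1) (w.snoc b')) (S.p_pos (k + 1)).le
    exact disjoint_left.1 hdisj hmem hmem
  rw [e, e']
  exact hij.imp (fun h => le_abs_sub_natCast_mul h hs _) (fun h => le_abs_sub_natCast_mul h hs _)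

/-- Points of two squares whose words differ in position `j` are at least `a_j` apart. -/
theorem gap_le_dist {α β : Code m} {j k : ℕ} (hjk : j ≤ k) (h : α j ≠ β j) {z w : Plane}
    (hz : z ∈ S.square (α.trunc k)) (hw : w ∈ S.square (β.trunc k)) : S.a j ≤ dist z w := by
  classical
  have hex : ∃ l, α l ≠ β l := ⟨j, h⟩
  set l := Nat.find hex with hl
  have hlj : l ≤ j := Nat.find_min' hex h
  have hne : α l ≠ β l := Nat.find_spec hex
  have heq : ∀ i < l, α i = β i := fun i hi => not_not.1 (Nat.find_min hex hi)
  -- At the first disagreement `l ≤ j` the enclosing squares of level `l` are siblings, so they are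
  -- separated by `a l`, which is at least `a j`.
  refine (S.a_decreasing.antitone hlj).trans ?_
  have hz' := S.square_subset (hlj.trans hjk) hz
  have hw' := S.square_subset (hlj.trans hjk) hw
  clear_value l
  cases l with
  | zero => exact le_dist_of_corner_gap hz' hw' (S.corner_gap_zero hne)
  | succ l =>
    simp only [Code.trunc] at hz' hw'
    rw [← Code.trunc_congr fun i hi => heq i (by omega)] at hw'
    exact le_dist_of_corner_gap hz' hw' (S.corner_gap_succ hne)

theorem gap_le_dist_point {α β : Code m} {j : ℕ} (h : α j ≠ β j) :
    S.a j ≤ dist (S.point α) (S.point β) :=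
  S.gap_le_dist le_rfl h (S.point_mem α j) (S.point_mem β j)

theorem dist_point_le {α β : Code m} {k : ℕ} (h : ∀ j ≤ k, α j = β j) :
    dist (S.point α) (S.point β) ≤ √2 * S.p k := by
  refine dist_le_of_mem_closedSquare (S.point_mem α k) ?_
  rw [Code.trunc_congr h]
  exact S.point_mem β k

theorem agree_of_dist_lt {α β : Code m} {k : ℕ} (h : dist (S.point α) (S.point β) < S.a k) :
    ∀ j ≤ k, α j = β j := by
  intro j hj
  by_contra hne
  exact absurd ((S.a_decreasing.antitone hj).trans (S.gap_le_dist_point hne)) (not_le.2 h)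

theorem diam_lt (k : ℕ) : √2 * S.p k < K * q ^ m k * S.a k := by
  have h := S.ratio_lt k
  rw [div_lt_div_iff₀ (S.a_pos k) (by positivity)] at h
  linarith

theorem continuous_point : Continuous S.point := by
  refine continuous_iff_continuousAt.2 fun α => Metric.tendsto_nhds.2 fun ε hε => ?_
  have hlim : Filter.Tendsto (fun k => √2 * S.p k) Filter.atTop (nhds 0) := by
    simpa using S.p_tendsto.const_mul (√2)
  obtain ⟨k, hk⟩ := (hlim.eventually (gt_mem_nhds hε)).exists
  filter_upwards [α.eventually_agree k] with β hβ
  exact (S.dist_point_le hβ).trans_lt hk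

instance : CompactSpace S.cantorSet :=
  isCompact_iff_compactSpace.1 (isCompact_range S.continuous_point)

instance : Nonempty S.cantorSet := (range_nonempty S.point).to_subtype

theorem continuous_codeEquiv : Continuous S.codeEquiv :=
  S.continuous_point.subtype_mk _

theorem coe_codeEquiv (α : Code m) : (S.codeEquiv α : Plane) = S.point α := rfl

theorem dist_codeEquiv (α β : Code m) :
    dist (S.codeEquiv α) (S.codeEquiv β) = dist (S.point α) (S.point β) := rfl

/-! ## The first part of the theorem -/

theorem gifsMap_codeEquiv (i : Fin 4) (α : ℕ → Code m)
    (h : Bornology.IsBounded (range fun j => S.codeEquiv (α j))) :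
    S.gifsMap i ⟨fun j => S.codeEquiv (α j), h⟩ = S.codeEquiv (Code.merge i α) := by
  simp [gifsMap]

/-- Only the compactness of `C` matters: every closed subset is compact. -/
theorem isGIFSInfty : IsGIFSInfty S.gifsMap := by
  refine fun i L => ⟨?_, isClosed_closure.isCompact⟩
  choose x hx using fun k => (L.1 k).nonempty
  have hmem : (⟨x, Bornology.IsBounded.all _⟩ : LInfty S.cantorSet) ∈ prodSet L := hx
  exact (Set.Nonempty.image _ ⟨_, hmem⟩).closure

theorem bddAbove_distSQ (hq : 0 ≤ q) (hq1 : q ≤ 1) (x y : LInfty S.cantorSet) :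
    BddAbove (range fun k : ℕ => q ^ k * dist (x.1 k) (y.1 k)) := by
  refine ⟨Metric.diam (univ : Set S.cantorSet), ?_⟩
  rintro _ ⟨k, rfl⟩
  have h := Metric.dist_le_diam_of_mem (Bornology.IsBounded.all (univ : Set S.cantorSet))
    (mem_univ (x.1 k)) (mem_univ (y.1 k))
  exact (mul_le_of_le_one_left dist_nonneg (pow_le_one₀ hq hq1)).trans h

/-- The constant is `K * q` rather than `K`; the extra factor `q` later makes the bound on the
Lipschitz constant strict. -/
theorem dist_gifsMap_le (hK : 0 ≤ K) (hq : 0 < q) (hq1 : q ≤ 1) (i : Fin 4)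
    (x y : LInfty S.cantorSet) :
    dist (S.gifsMap i x) (S.gifsMap i y) ≤ K * q * distSQ q x y := by
  classical
  have hbdd := S.bddAbove_distSQ hq.le hq1 x y
  have hnonneg : 0 ≤ distSQ q x y := Real.iSup_nonneg fun k => by positivity
  set α : Code m := Code.merge i fun j => S.codeEquiv.symm (x.1 j) with hα
  set β : Code m := Code.merge i fun j => S.codeEquiv.symm (y.1 j) with hβ
  change dist (S.codeEquiv α) (S.codeEquiv β) ≤ _
  by_cases hαβ : α = β
  · rw [hαβ, dist_self]; positivity
  have hex : ∃ l, α l ≠ β l := by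
    by_contra! hcon
    exact hαβ (funext hcon)
  set l := Nat.find hex
  have hne : α l ≠ β l := Nat.find_spec hex
  have heq : ∀ i < l, α i = β i := fun i hi => not_not.1 (Nat.find_min hex hi)
  clear_value l
  cases l with
  -- Both merged codes begin with the letter `i`.
  | zero => exact absurd rfl hne
  | succ k =>
    obtain ⟨j, hj⟩ : ∃ j : Fin (m k),
        (S.codeEquiv.symm (x.1 j)) k ≠ (S.codeEquiv.symm (y.1 j)) k := by
      by_contra! hcon
      exact hne (funext hcon)
    have h1 := S.gap_le_dist_point hj
    rw [← dist_codeEquiv, Equiv.apply_symm_apply, Equiv.apply_symm_apply] at h1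
    have h2 : q ^ (j : ℕ) * dist (x.1 j) (y.1 j) ≤ distSQ q x y := le_ciSup hbdd (j : ℕ)
    have h3 := (S.dist_point_le fun i hi => heq i (by omega)).trans (S.diam_lt k).le
    have h5 := S.a_pos k
    -- Arguments are numbered from `0`, so `j + 1 ≤ m k`; this is where the extra `q` comes from.
    have h4 : q ^ m k ≤ q * q ^ (j : ℕ) := by
      rw [← pow_succ']
      exact pow_le_pow_of_le_one hq.le hq1 j.2
    calc dist (S.codeEquiv α) (S.codeEquiv β) ≤ K * q ^ m k * S.a k := h3
      _ ≤ K * (q * q ^ (j : ℕ)) * dist (x.1 j) (y.1 j) := by gcongr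
      _ = K * q * (q ^ (j : ℕ) * dist (x.1 j) (y.1 j)) := by ring
      _ ≤ K * q * distSQ q x y := by gcongr

theorem lipFamilySQ_gifsMap_lt (hK : 0 < K) (hq : 0 < q) (hq1 : q < 1) :
    lipFamilySQ q S.gifsMap < ENNReal.ofReal K := by
  have h : lipFamilySQ q S.gifsMap ≤ ENNReal.ofReal (K * q) :=
    iSup_le fun i => iInf₂_le (Real.toNNReal (K * q)) fun x y => by
      rw [Real.coe_toNNReal _ (by positivity)]
      exact S.dist_gifsMap_le hK.le hq hq1.le i x y
  exact h.trans_lt ((ENNReal.ofReal_lt_ofReal_iff hK).2 (mul_lt_of_lt_one_right hK hq1))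

theorem condQ_gifsMap (hK : 0 < K) (hK1 : K < 1) (hq : 0 < q) (hq1 : q < 1) :
    CondQ S.gifsMap :=
  ⟨q, hq, hq1, (S.lipFamilySQ_gifsMap_lt hK hq hq1).trans_le
    (by simpa using ENNReal.ofReal_le_ofReal hK1.le)⟩

/-- Splitting the tuples of a code into their entries inverts the merge, so the images cover `C`
even before closures are taken. -/
theorem exists_gifsMap_eq (y : S.cantorSet) :
    ∃ i, ∃ x : LInfty S.cantorSet, S.gifsMap i x = y := by
  classical
  obtain ⟨γ, rfl⟩ := S.codeEquiv.surjective y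
  obtain ⟨δ⟩ := Code.instNonempty m
  let α : ℕ → Code m := fun j l => if hj : j < m l then γ (l + 1) ⟨j, hj⟩ else δ l
  refine ⟨γ 0, ⟨fun j => S.codeEquiv (α j), Bornology.IsBounded.all _⟩, ?_⟩
  refine (S.gifsMap_codeEquiv _ _ _).trans (congrArg _ (funext fun l => ?_))
  cases l with
  | zero => rfl
  | succ l => exact funext fun j : Fin (m l) => dif_pos j.2

theorem isGIFSInftyAttractor_of_eq_univ {A : TopologicalSpace.NonemptyCompacts S.cantorSet}
    (hA : (A : Set S.cantorSet) = univ) : IsGIFSInftyAttractor S.gifsMap A := by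
  rw [IsGIFSInftyAttractor, hA, eq_univ_iff_forall]
  intro y
  obtain ⟨i, x, rfl⟩ := S.exists_gifsMap_eq y
  refine mem_iUnion.2 ⟨i, subset_closure (mem_image_of_mem _ fun k => ?_)⟩
  change x.1 k ∈ (A : Set S.cantorSet)
  rw [hA]; trivial

/-- The codes of points of `B` are stable under merging, so they realize every initial segment; `B`
is therefore dense, and it is closed. -/
theorem eq_univ_of_isGIFSInftyAttractor {B : TopologicalSpace.NonemptyCompacts S.cantorSet}
    (hB : IsGIFSInftyAttractor S.gifsMap B) : (B : Set S.cantorSet) = univ := by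
  have hsub : ∀ i, closure (S.gifsMap i '' prodSet (LInfty.const B)) ⊆ B := fun i => by
    have := hB.le
    exact (subset_iUnion (fun i => closure (S.gifsMap i '' prodSet (LInfty.const B))) i).trans this
  have hne : (S.codeEquiv ⁻¹' (B : Set S.cantorSet)).Nonempty :=
    B.nonempty.preimage S.codeEquiv.surjective
  have hmerge : ∀ i (α : ℕ → Code m), (∀ j, α j ∈ S.codeEquiv ⁻¹' (B : Set S.cantorSet)) →
      Code.merge i α ∈ S.codeEquiv ⁻¹' (B : Set S.cantorSet) := fun i α hα => by
    refine hsub i (subset_closure ⟨⟨fun j => S.codeEquiv (α j), Bornology.IsBounded.all _⟩, hα, ?_⟩)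
    exact S.gifsMap_codeEquiv i α _
  refine eq_univ_iff_forall.2 fun y => ?_
  obtain ⟨γ, rfl⟩ := S.codeEquiv.surjective y
  rw [← B.isCompact.isClosed.closure_eq, Metric.mem_closure_iff]
  intro ε hε
  have hlim : Filter.Tendsto (fun k => √2 * S.p k) Filter.atTop (nhds 0) := by
    simpa using S.p_tendsto.const_mul (√2)
  obtain ⟨k, hk⟩ := (hlim.eventually (gt_mem_nhds hε)).exists
  obtain ⟨β, hβ, hβγ⟩ := Code.exists_agree_of_merge_mem hne hmerge k γ
  exact ⟨S.codeEquiv β, hβ, (S.dist_point_le fun j hj => (hβγ j hj).symm).trans_lt hk⟩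

theorem exists_unique_attractor : ∃ A : TopologicalSpace.NonemptyCompacts S.cantorSet,
    (A : Set S.cantorSet) = univ ∧ IsGIFSInftyAttractor S.gifsMap A ∧
    ∀ B : TopologicalSpace.NonemptyCompacts S.cantorSet,
      IsGIFSInftyAttractor S.gifsMap B → B = A := by
  have h : ((⊤ : TopologicalSpace.NonemptyCompacts S.cantorSet) : Set S.cantorSet) = univ :=
    TopologicalSpace.NonemptyCompacts.coe_top
  refine ⟨⊤, h, S.isGIFSInftyAttractor_of_eq_univ h, fun B hB => ?_⟩
  exact SetLike.coe_injective ((S.eq_univ_of_isGIFSInftyAttractor hB).trans h.symm)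

end SquareConstruction

namespace SquareConstruction

variable {K q : ℝ} {m : ℕ → ℕ} (S : SquareConstruction K q m)

/-- This lets any two points of one square be joined by a single jump at the scale of the gaps. -/
theorem diam_lt_gap (hK1 : K ≤ 1) (hq : 0 ≤ q) (hq1 : q ≤ 1) (k : ℕ) :
    √2 * S.p k < S.a k := by
  refine (S.diam_lt k).trans_le (mul_le_of_le_one_left (S.a_pos k).le ?_)
  exact mul_le_one₀ hK1 (pow_nonneg hq _) (pow_le_one₀ hq hq1)

/-! ## Cells of the grids and corners of squares -/

/-- Every cell of the grid in a square contains a square of the next level. -/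
theorem exists_corner_eq (k : ℕ) (w : Word m k) {i j : ℕ} (hi : i < gridSize m k)
    (hj : j < gridSize m k) : ∃ b : Alphabet m (k + 1), S.corner (k + 1) (w.snoc b) =
      ((S.corner k w).1 + i * (S.p (k + 1) + S.a (k + 1)),
        (S.corner k w).2 + j * (S.p (k + 1) + S.a (k + 1))) := by
  choose f g hf hg hc using fun b => S.corner_succ k w b
  let F : Alphabet m (k + 1) → Fin (gridSize m k) × Fin (gridSize m k) :=
    fun b => (⟨f b, hf b⟩, ⟨g b, hg b⟩)
  have hF : Function.Injective F := by
    intro b b' h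
    by_contra hne
    have h1 : f b = f b' := congrArg (fun x => (x.1 : ℕ)) h
    have h2 : g b = g b' := congrArg (fun x => (x.2 : ℕ)) h
    have := S.corner_gap_succ (w := w) hne
    rw [hc b, hc b', h1, h2, sub_self, sub_self, abs_zero, or_self] at this
    linarith [S.p_pos (k + 1), S.a_pos (k + 1)]
  -- Letters and cells are equally many, so distinct letters in distinct cells fill the grid.
  have hF' := hF.bijective_of_nat_card_le (by
    rw [Alphabet.card_succ, Nat.card_prod, Nat.card_fin])
  obtain ⟨b, hb⟩ := hF'.surjective (⟨i, hi⟩, ⟨j, hj⟩)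
  have h1 : f b = i := congrArg (fun x => (x.1 : ℕ)) hb
  have h2 : g b = j := congrArg (fun x => (x.2 : ℕ)) hb
  exact ⟨b, by rw [hc b, h1, h2]⟩

/-- The point of the square `I_w` with relative coordinates `s, t`. -/
noncomputable def vertex {k : ℕ} (w : Word m k) (s t : ℝ) : Plane :=
  !₂[(S.corner k w).1 + s * S.p k, (S.corner k w).2 + t * S.p k]

theorem vertex_mem_square {k : ℕ} (w : Word m k) {s t : ℝ} (hs : s ∈ Icc (0 : ℝ) 1)
    (ht : t ∈ Icc (0 : ℝ) 1) : S.vertex w s t ∈ S.square w := by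
  have hp := S.p_pos k
  have key : ∀ u s : ℝ, s ∈ Icc (0 : ℝ) 1 → u + s * S.p k ∈ Icc u (u + S.p k) := fun u s hs =>
    ⟨by nlinarith [hs.1], by nlinarith [hs.2]⟩
  exact ⟨key _ _ hs, key _ _ ht⟩

/-- A square contains a square of the next level with the same vertex. -/
theorem exists_snoc_vertex_eq {k : ℕ} (w : Word m k) {s t : ℝ} (hs : s = 0 ∨ s = 1)
    (ht : t = 0 ∨ t = 1) : ∃ b, S.vertex (w.snoc b) s t = S.vertex w s t := by
  have hN := one_le_gridSize m k
  have key : ∀ s : ℝ, s = 0 ∨ s = 1 → ∃ i : ℕ, i < gridSize m k ∧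
      i * (S.p (k + 1) + S.a (k + 1)) + s * S.p (k + 1) = s * S.p k := by
    rintro s (rfl | rfl)
    · exact ⟨0, hN, by simp⟩
    · refine ⟨gridSize m k - 1, by omega, ?_⟩
      rw [Nat.cast_sub hN]
      have := S.sides_succ k
      push_cast
      linarith
  obtain ⟨i, hi, ei⟩ := key s hs
  obtain ⟨j, hj, ej⟩ := key t ht
  obtain ⟨b, hb⟩ := S.exists_corner_eq k w hi hj
  refine ⟨b, ?_⟩
  rw [vertex, vertex, hb]
  simp only [add_assoc, ei, ej]

/-- A vertex of a square is also a vertex of arbitrarily small squares of later levels. Each of them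
contains a point of `C`, and `C` is closed. -/
theorem vertex_mem_cantorSet {k : ℕ} (w : Word m k) {s t : ℝ} (hs : s = 0 ∨ s = 1)
    (ht : t = 0 ∨ t = 1) : S.vertex w s t ∈ S.cantorSet := by
  have hI : ∀ s : ℝ, s = 0 ∨ s = 1 → s ∈ Icc (0 : ℝ) 1 := by
    rintro s (rfl | rfl) <;> simp
  have hclosed : IsClosed S.cantorSet := (isCompact_range S.continuous_point).isClosed
  rw [← hclosed.closure_eq, Metric.mem_closure_iff]
  intro ε hε
  have hlim : Filter.Tendsto (fun k => √2 * S.p k) Filter.atTop (nhds 0) := by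
    simpa using S.p_tendsto.const_mul (√2)
  have hext : ∀ d, ∃ w' : Word m (k + d), S.vertex w' s t = S.vertex w s t := by
    intro d
    induction d with
    | zero => exact ⟨w, rfl⟩
    | succ d ih =>
      obtain ⟨w', hw'⟩ := ih
      obtain ⟨b, hb⟩ := S.exists_snoc_vertex_eq w' hs ht
      exact ⟨w'.snoc b, hb.trans hw'⟩
  obtain ⟨l, hl, hkl⟩ :=
    ((hlim.eventually (gt_mem_nhds hε)).and (Filter.eventually_ge_atTop k)).exists
  obtain ⟨d, rfl⟩ := Nat.exists_eq_add_of_le hkl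
  obtain ⟨w', hw'⟩ := hext d
  obtain ⟨α, rfl⟩ := Code.exists_trunc_eq _ w'
  refine ⟨S.point α, mem_range_self _, lt_of_le_of_lt ?_ hl⟩
  rw [← hw']
  exact dist_le_of_mem_closedSquare (S.vertex_mem_square _ (hI s hs) (hI t ht)) (S.point_mem α _)

/-! ## Chains -/

/-- The equivalence relation generated by the pairs of points of `C` at distance at most `δ`. -/
def Chain (δ : ℝ) : S.cantorSet → S.cantorSet → Prop :=
  Relation.EqvGen fun u v => dist u v ≤ δ

section

variable {S} {δ : ℝ}

theorem Chain.of_dist_le {u v : S.cantorSet} (h : dist u v ≤ δ) : S.Chain δ u v :=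
  Relation.EqvGen.rel _ _ h

theorem Chain.symm {u v : S.cantorSet} (h : S.Chain δ u v) : S.Chain δ v u :=
  Relation.EqvGen.symm _ _ h

theorem Chain.trans {u v w : S.cantorSet} (h : S.Chain δ u v) (h' : S.Chain δ v w) :
    S.Chain δ u w :=
  Relation.EqvGen.trans _ _ _ h h'

theorem chain_of_mem_square {k : ℕ} {w : Word m k} (hδ : √2 * S.p k ≤ δ) {u v : S.cantorSet}
    (hu : (u : Plane) ∈ S.square w) (hv : (v : Plane) ∈ S.square w) : S.Chain δ u v :=
  Chain.of_dist_le ((dist_le_of_mem_closedSquare hu hv).trans hδ)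

/-- The jumps go from `u` to a vertex of its square, across to a vertex of the other square, and on
to `v`. Vertices serve as relay points because they belong to `C`; facing vertices of neighbouring
squares are exactly one gap apart. -/
theorem chain_of_vertex_dist_le {k : ℕ} {w w' : Word m k} (hδ : √2 * S.p k ≤ δ)
    {s t s' t' : ℝ} (hs : s = 0 ∨ s = 1) (ht : t = 0 ∨ t = 1) (hs' : s' = 0 ∨ s' = 1)
    (ht' : t' = 0 ∨ t' = 1) (h : dist (S.vertex w s t) (S.vertex w' s' t') ≤ δ)
    {u v : S.cantorSet} (hu : (u : Plane) ∈ S.square w) (hv : (v : Plane) ∈ S.square w') :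
    S.Chain δ u v := by
  have hI : ∀ s : ℝ, s = 0 ∨ s = 1 → s ∈ Icc (0 : ℝ) 1 := by
    rintro s (rfl | rfl) <;> simp
  obtain ⟨x, hx⟩ : ∃ x : S.cantorSet, (x : Plane) = S.vertex w s t :=
    ⟨⟨_, S.vertex_mem_cantorSet w hs ht⟩, rfl⟩
  obtain ⟨y, hy⟩ : ∃ y : S.cantorSet, (y : Plane) = S.vertex w' s' t' :=
    ⟨⟨_, S.vertex_mem_cantorSet w' hs' ht'⟩, rfl⟩
  have hxy : dist x y ≤ δ := by rwa [Subtype.dist_eq, hx, hy]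
  have hux := chain_of_mem_square hδ hu (hx ▸ S.vertex_mem_square w (hI _ hs) (hI _ ht))
  have hyv := chain_of_mem_square hδ (hy ▸ S.vertex_mem_square w' (hI _ hs') (hI _ ht')) hv
  exact (hux.trans (Chain.of_dist_le hxy)).trans hyv

theorem chain_of_right_neighbour {k : ℕ} {w w' : Word m k} (hδ : √2 * S.p k ≤ S.a k)
    (h1 : (S.corner k w').1 = (S.corner k w).1 + (S.p k + S.a k))
    (h2 : (S.corner k w').2 = (S.corner k w).2)
    {u v : S.cantorSet} (hu : (u : Plane) ∈ S.square w) (hv : (v : Plane) ∈ S.square w') :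
    S.Chain (S.a k) u v := by
  refine chain_of_vertex_dist_le (s := 1) (t := 0) (s' := 0) (t' := 0) hδ (by simp) (by simp)
    (by simp) (by simp) (le_of_eq ?_) hu hv
  rw [EuclideanSpace.dist_eq, Fin.sum_univ_two, Real.dist_eq, Real.dist_eq, sq_abs, sq_abs]
  simp only [vertex, h1, h2]
  refine (Real.sqrt_eq_iff_eq_sq (by positivity) (S.a_pos k).le).2 ?_
  simp

theorem chain_of_upper_neighbour {k : ℕ} {w w' : Word m k} (hδ : √2 * S.p k ≤ S.a k)
    (h1 : (S.corner k w').1 = (S.corner k w).1)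
    (h2 : (S.corner k w').2 = (S.corner k w).2 + (S.p k + S.a k))
    {u v : S.cantorSet} (hu : (u : Plane) ∈ S.square w) (hv : (v : Plane) ∈ S.square w') :
    S.Chain (S.a k) u v := by
  refine chain_of_vertex_dist_le (s := 0) (t := 1) (s' := 0) (t' := 0) hδ (by simp) (by simp)
    (by simp) (by simp) (le_of_eq ?_) hu hv
  rw [EuclideanSpace.dist_eq, Fin.sum_univ_two, Real.dist_eq, Real.dist_eq, sq_abs, sq_abs]
  simp only [vertex, h1, h2]
  refine (Real.sqrt_eq_iff_eq_sq (by positivity) (S.a_pos k).le).2 ?_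
  simp

end

theorem exists_mem_square {k : ℕ} (w : Word m k) : ∃ u : S.cantorSet, (u : Plane) ∈ S.square w :=
  ⟨⟨_, S.vertex_mem_cantorSet w (Or.inl rfl) (Or.inl rfl)⟩,
    S.vertex_mem_square w (by simp) (by simp)⟩

/-- The part of `C` in a square of level `k` is chain connected at the scale of the gaps of
level `k + 1`. -/
theorem chain_of_mem_parent {k : ℕ} (w : Word m k) (hδ : √2 * S.p (k + 1) ≤ S.a (k + 1))
    {b b' : Alphabet m (k + 1)} {u v : S.cantorSet} (hu : (u : Plane) ∈ S.square (w.snoc b))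
    (hv : (v : Plane) ∈ S.square (w.snoc b')) : S.Chain (S.a (k + 1)) u v := by
  obtain ⟨b₀, hb₀⟩ := S.exists_corner_eq k w (i := 0) (j := 0) (one_le_gridSize m k)
    (one_le_gridSize m k)
  obtain ⟨u₀, hu₀⟩ := S.exists_mem_square (w.snoc b₀)
  have cast : ∀ i : ℕ, ∀ x : ℝ, ((i + 1 : ℕ) : ℝ) * x = i * x + x := fun i x => by push_cast; ring
  -- Every square is reached from the lower left cell: along the bottom row here, then up the
  -- columns in `all`.
  have row : ∀ i, i < gridSize m k → ∀ (b : Alphabet m (k + 1)) (u : S.cantorSet),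
      S.corner (k + 1) (w.snoc b) = ((S.corner k w).1 + i * (S.p (k + 1) + S.a (k + 1)),
        (S.corner k w).2 + (0 : ℕ) * (S.p (k + 1) + S.a (k + 1))) →
      (u : Plane) ∈ S.square (w.snoc b) → S.Chain (S.a (k + 1)) u₀ u := by
    intro i
    induction i with
    | zero =>
      intro _ b u hb hu
      have hsq : S.square (w.snoc b) = S.square (w.snoc b₀) := by rw [square, square, hb, hb₀]
      exact chain_of_mem_square hδ hu₀ (hsq ▸ hu)
    | succ i ih =>
      intro hi b u hb hu
      obtain ⟨b₁, hb₁⟩ := S.exists_corner_eq k w (i := i) (j := 0) (by omega) (by omega)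
      obtain ⟨u₁, hu₁⟩ := S.exists_mem_square (w.snoc b₁)
      refine (ih (by omega) b₁ u₁ hb₁ hu₁).trans (chain_of_right_neighbour hδ ?_ ?_ hu₁ hu)
      · rw [hb, hb₁]; simp only [cast]; ring
      · rw [hb, hb₁]
  have all : ∀ j, j < gridSize m k → ∀ i, i < gridSize m k →
      ∀ (b : Alphabet m (k + 1)) (u : S.cantorSet),
      S.corner (k + 1) (w.snoc b) = ((S.corner k w).1 + i * (S.p (k + 1) + S.a (k + 1)),
        (S.corner k w).2 + j * (S.p (k + 1) + S.a (k + 1))) →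
      (u : Plane) ∈ S.square (w.snoc b) → S.Chain (S.a (k + 1)) u₀ u := by
    intro j
    induction j with
    | zero => exact fun _ => row
    | succ j ih =>
      intro hj i hi b u hb hu
      obtain ⟨b₁, hb₁⟩ := S.exists_corner_eq k w (i := i) (j := j) hi (by omega)
      obtain ⟨u₁, hu₁⟩ := S.exists_mem_square (w.snoc b₁)
      refine (ih (by omega) i hi b₁ u₁ hb₁ hu₁).trans (chain_of_upper_neighbour hδ ?_ ?_ hu₁ hu)
      · rw [hb, hb₁]
      · rw [hb, hb₁]; simp only [cast]; ring
  obtain ⟨i, j, hi, hj, e⟩ := S.corner_succ k w b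
  obtain ⟨i', j', hi', hj', e'⟩ := S.corner_succ k w b'
  exact (all j hj i hi b u e hu).symm.trans (all j' hj' i' hi' b' v e' hv)

/-! ## Initial segments of codes -/

/-- The letters in positions `0, ..., k` of the code of a point of `C`. -/
noncomputable def initial (k : ℕ) (u : S.cantorSet) : ∀ j : Finset.range (k + 1), Alphabet m j :=
  fun j => S.codeEquiv.symm u j

theorem initial_eq_iff {k : ℕ} {u v : S.cantorSet} : S.initial k u = S.initial k v ↔
    ∀ j ≤ k, S.codeEquiv.symm u j = S.codeEquiv.symm v j := by
  refine ⟨fun h j hj => congrFun h ⟨j, Finset.mem_range_succ_iff.2 hj⟩, fun h => ?_⟩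
  exact funext fun j => h j (Finset.mem_range_succ_iff.1 j.2)

theorem initial_eq_of_dist_lt {k : ℕ} {u v : S.cantorSet} (h : dist u v < S.a k) :
    S.initial k u = S.initial k v := by
  refine S.initial_eq_iff.2 (S.agree_of_dist_lt ?_)
  rwa [← dist_codeEquiv, Equiv.apply_symm_apply, Equiv.apply_symm_apply]

theorem mem_square_codeEquiv_symm (u : S.cantorSet) (k : ℕ) :
    (u : Plane) ∈ S.square ((S.codeEquiv.symm u).trunc k) := by
  have := S.point_mem (S.codeEquiv.symm u) k
  rwa [← coe_codeEquiv, Equiv.apply_symm_apply] at this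

theorem chain_of_initial_eq {k : ℕ} (hδ : √2 * S.p (k + 1) ≤ S.a (k + 1)) {u v : S.cantorSet}
    (h : S.initial k u = S.initial k v) : S.Chain (S.a (k + 1)) u v := by
  have hu := S.mem_square_codeEquiv_symm u (k + 1)
  have hv := S.mem_square_codeEquiv_symm v (k + 1)
  simp only [Code.trunc] at hu hv
  rw [Code.trunc_congr (S.initial_eq_iff.1 h)] at hu
  exact S.chain_of_mem_parent _ hδ hu hv

/-! ## Generalized weak contractions -/

/-- A generalized weak contraction maps each cell of level `k` into a square of level `k + 1`. -/
theorem initial_succ_eq_of_isGenWeakContraction {k n : ℕ}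
    (hδ : √2 * S.p (k + 1) ≤ S.a (k + 1)) {g : (Fin n → S.cantorSet) → S.cantorSet}
    (hg : IsGenWeakContraction g) {x y : Fin n → S.cantorSet}
    (h : ∀ t, S.initial k (x t) = S.initial k (y t)) :
    S.initial (k + 1) (g x) = S.initial (k + 1) (g y) := by
  classical
  -- Moving one coordinate by a jump of length at most `a (k + 1)` moves the tuple by no more in the
  -- maximum metric, so its image moves by strictly less than `a (k + 1)`.
  have step : ∀ (x : Fin n → S.cantorSet) (t : Fin n) (u v : S.cantorSet),
      S.Chain (S.a (k + 1)) u v → S.initial (k + 1) (g (Function.update x t u)) =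
        S.initial (k + 1) (g (Function.update x t v)) := by
    intro x t u v huv
    induction huv with
    | rel u v huv =>
      by_cases hne : Function.update x t u = Function.update x t v
      · rw [hne]
      refine S.initial_eq_of_dist_lt ((hg _ _ hne).trans_le ?_)
      refine (dist_pi_le_iff (S.a_pos _).le).2 fun s => ?_
      by_cases hst : s = t
      · subst hst; simpa using huv
      · simpa [hst] using (S.a_pos (k + 1)).le
    | refl u => rfl
    | symm u v _ ih => exact ih.symm
    | trans u v w _ _ ih1 ih2 => exact ih1.trans ih2
  -- Pass from `x` to `y` by replacing one coordinate at a time.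
  have key : ∀ s : Finset (Fin n),
      S.initial (k + 1) (g x) = S.initial (k + 1) (g (s.piecewise y x)) := by
    intro s
    induction s using Finset.induction_on with
    | empty => rw [Finset.piecewise_empty]
    | insert t s hts ih =>
      rw [ih, Finset.piecewise_insert]
      conv_lhs => rw [← Function.update_eq_self t (s.piecewise y x)]
      refine step _ _ _ _ (S.chain_of_initial_eq hδ ?_)
      rw [Finset.piecewise_eq_of_notMem _ _ _ hts]
      exact h t
  have := key Finset.univ
  rwa [Finset.piecewise_univ] at this

end SquareConstruction

open MeasureTheory

/-! ## The uniform measure -/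

instance Alphabet.instMeasurableSpace (m : ℕ → ℕ) (k : ℕ) : MeasurableSpace (Alphabet m k) := ⊤

instance Alphabet.instDiscreteMeasurableSpace (m : ℕ → ℕ) (k : ℕ) :
    DiscreteMeasurableSpace (Alphabet m k) :=
  ⟨fun _ => trivial⟩

instance Code.instMeasurableSpace (m : ℕ → ℕ) : MeasurableSpace (Code m) :=
  inferInstanceAs (MeasurableSpace (∀ k, Alphabet m k))

instance Code.instBorelSpace (m : ℕ → ℕ) : BorelSpace (Code m) :=
  inferInstanceAs (BorelSpace (∀ k, Alphabet m k))

noncomputable instance Alphabet.instFintype (m : ℕ → ℕ) (k : ℕ) : Fintype (Alphabet m k) :=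
  Fintype.ofFinite _

/-- The uniform distribution on an alphabet. -/
noncomputable def Alphabet.uniform (m : ℕ → ℕ) (k : ℕ) : Measure (Alphabet m k) :=
  (PMF.uniformOfFintype (Alphabet m k)).toMeasure

instance (m : ℕ → ℕ) (k : ℕ) : IsProbabilityMeasure (Alphabet.uniform m k) :=
  inferInstanceAs (IsProbabilityMeasure (PMF.toMeasure _))

theorem Alphabet.uniform_singleton (m : ℕ → ℕ) (k : ℕ) (b : Alphabet m k) :
    Alphabet.uniform m k {b} = ((4 : ℝ≥0∞) ^ ∏ i ∈ Finset.range k, m i)⁻¹ := by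
  rw [uniform, PMF.toMeasure_apply_singleton _ _ (measurableSet_singleton b),
    PMF.uniformOfFintype_apply, Fintype.card_eq_nat_card, Alphabet.card]
  push_cast
  rfl

/-- The product of the uniform distributions. -/
noncomputable def Code.uniform (m : ℕ → ℕ) : Measure (Code m) :=
  Measure.infinitePi (Alphabet.uniform m)

instance (m : ℕ → ℕ) : IsProbabilityMeasure (Code.uniform m) :=
  inferInstanceAs (IsProbabilityMeasure (Measure.infinitePi (Alphabet.uniform m)))

theorem Code.uniform_cylinder (m : ℕ → ℕ) (k : ℕ) (γ : Code m) :
    Code.uniform m {α | ∀ j ≤ k, α j = γ j} =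
      ((4 : ℝ≥0∞) ^ ∑ j ∈ Finset.range (k + 1), ∏ i ∈ Finset.range j, m i)⁻¹ := by
  have hset : {α : Code m | ∀ j ≤ k, α j = γ j} =
      Set.pi (Finset.range (k + 1) : Set ℕ) fun j => {γ j} := by
    ext α
    exact forall_congr' fun j => by rw [Finset.mem_coe, Finset.mem_range_succ_iff]; rfl
  rw [hset]
  refine (Measure.infinitePi_pi (Alphabet.uniform m) fun j _ => measurableSet_singleton (γ j)).trans ?_
  simp only [Alphabet.uniform_singleton]
  rw [← Finset.prod_pow_eq_pow_sum, ENNReal.prod_inv_distrib]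
  intro i _ j _ _
  exact Or.inr (by simp)

namespace SquareConstruction

variable {K q : ℝ} {m : ℕ → ℕ} (S : SquareConstruction K q m)

/-- The image on `C` of the product of the uniform distributions. -/
noncomputable def uniform : Measure S.cantorSet := (Code.uniform m).map S.codeEquiv

instance : IsProbabilityMeasure S.uniform :=
  Measure.isProbabilityMeasure_map S.continuous_codeEquiv.aemeasurable

/-- A continuous injection of a compact space into a Hausdorff space is a closed embedding. The
pushforward can then be evaluated on any set without checking measurability. -/
theorem measurableEmbedding_codeEquiv : MeasurableEmbedding S.codeEquiv :=
  (S.continuous_codeEquiv.isClosedEmbedding S.codeEquiv.injective).measurableEmbedding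

theorem uniform_initial_eq (k : ℕ) (v : S.cantorSet) :
    S.uniform {u | S.initial k u = S.initial k v} =
      ((4 : ℝ≥0∞) ^ ∑ j ∈ Finset.range (k + 1), ∏ i ∈ Finset.range j, m i)⁻¹ := by
  rw [uniform, S.measurableEmbedding_codeEquiv.map_apply,
    ← Code.uniform_cylinder m k (S.codeEquiv.symm v)]
  congr 1
  ext α
  rw [mem_preimage, mem_ofPred_eq, S.initial_eq_iff, Equiv.symm_apply_apply]
  rfl

theorem card_initial (m : ℕ → ℕ) (k : ℕ) :
    Nat.card (∀ j : Finset.range (k + 1), Alphabet m j) =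
      4 ^ ∑ j ∈ Finset.range (k + 1), ∏ i ∈ Finset.range j, m i := by
  rw [Nat.card_pi, ← Finset.prod_pow_eq_pow_sum]
  simp only [Alphabet.card]
  exact Finset.prod_coe_sort (Finset.range (k + 1)) fun j => 4 ^ ∏ i ∈ Finset.range j, m i

/-- The first factor counts the `n`-tuples of squares of level `k`; the second is the mass of the
square of level `k + 1` that contains the image of such a tuple. -/
theorem uniform_range_le {k n : ℕ} (hδ : √2 * S.p (k + 1) ≤ S.a (k + 1))
    {g : (Fin n → S.cantorSet) → S.cantorSet} (hg : IsGenWeakContraction g) :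
    S.uniform (range g) ≤
      ((4 : ℝ≥0∞) ^ ∑ j ∈ Finset.range (k + 1), ∏ i ∈ Finset.range j, m i) ^ n *
      ((4 : ℝ≥0∞) ^ ∑ j ∈ Finset.range (k + 2), ∏ i ∈ Finset.range j, m i)⁻¹ := by
  classical
  set T : (Fin n → ∀ j : Finset.range (k + 1), Alphabet m j) → Set S.cantorSet :=
    fun v => g '' {x | ∀ t, S.initial k (x t) = v t} with hT
  have hcover : range g ⊆ ⋃ v, T v := by
    rintro _ ⟨x, rfl⟩
    exact mem_iUnion.2 ⟨fun t => S.initial k (x t), x, fun t => rfl, rfl⟩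
  have hcell : ∀ v, S.uniform (T v) ≤
      ((4 : ℝ≥0∞) ^ ∑ j ∈ Finset.range (k + 2), ∏ i ∈ Finset.range j, m i)⁻¹ := by
    intro v
    rcases (T v).eq_empty_or_nonempty with h | ⟨_, x, hx, rfl⟩
    · simp [h]
    · rw [← S.uniform_initial_eq (k + 1) (g x)]
      refine measure_mono ?_
      rintro _ ⟨y, hy, rfl⟩
      exact S.initial_succ_eq_of_isGenWeakContraction hδ hg fun t => (hy t).trans (hx t).symm
  have : Fintype (Fin n → ∀ j : Finset.range (k + 1), Alphabet m j) := Fintype.ofFinite _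
  calc S.uniform (range g) ≤ S.uniform (⋃ v, T v) := measure_mono hcover
    _ ≤ ∑ v, S.uniform (T v) := measure_iUnion_fintype_le _ _
    _ ≤ _ := Finset.sum_le_sum fun v _ => hcell v
    _ = _ := by
      rw [Finset.sum_const, Finset.card_univ, nsmul_eq_mul, Fintype.card_eq_nat_card, Nat.card_fun,
        card_initial, Nat.card_fin]
      push_cast
      rfl

theorem uniform_range_eq_zero (hδ : ∀ k, √2 * S.p k ≤ S.a k) (hm : GrowsFast m) {n : ℕ}
    {g : (Fin n → S.cantorSet) → S.cantorSet} (hg : IsGenWeakContraction g) :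
    S.uniform (range g) = 0 := by
  have hbound : ∀ k, max n 1 ≤ k → S.uniform (range g) ≤ (4⁻¹ : ℝ≥0∞) ^ k := by
    intro k hk
    refine (S.uniform_range_le (k := k) (hδ _) hg).trans ?_
    have hgrow := hm k ((le_max_right _ _).trans hk)
    have hn : n ≤ k := (le_max_left _ _).trans hk
    rw [Finset.sum_range_succ _ (k + 1)]
    set A := ∑ j ∈ Finset.range (k + 1), ∏ i ∈ Finset.range j, m i with hA
    set B := ∏ i ∈ Finset.range (k + 1), m i with hB
    -- The growth condition reads `A * (k - 1) + k < B`, and `A * n ≤ A * k` because `n ≤ k`.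
    have hexp : A * n + k ≤ A + B := by
      have h1 : (A : ℤ) * ((k : ℤ) - 1) - B < -(k : ℤ) := by
        rw [hA, hB]; push_cast; exact hgrow
      have h2 : A * n ≤ A * k := Nat.mul_le_mul_left _ hn
      zify at h2 ⊢
      linarith
    rw [← pow_mul, ← div_eq_mul_inv]
    refine ENNReal.div_le_of_le_mul ?_
    rw [mul_comm (4⁻¹ ^ k), ← ENNReal.inv_pow, ← div_eq_mul_inv,
      ENNReal.le_div_iff_mul_le (by simp) (by simp), ← pow_add]
    exact pow_le_pow_right₀ (by norm_num) hexp
  have hlim : Filter.Tendsto (fun k : ℕ => (4⁻¹ : ℝ≥0∞) ^ k) Filter.atTop (nhds 0) :=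
    ENNReal.tendsto_pow_atTop_nhds_zero_of_lt_one (ENNReal.inv_lt_one.2 (by norm_num))
  exact le_antisymm (ge_of_tendsto hlim
    ((Filter.eventually_ge_atTop (max n 1)).mono hbound)) zero_le

end SquareConstruction

/-! ### From null ranges to the absence of attractors, and the main theorem. -/

theorem not_isGIFSAttractor_of_measure_range_eq_zero {X : Type*} [MetricSpace X]
    [MeasurableSpace X] {μ : Measure X} [NeZero μ] {n r : ℕ} {g : Fin r → (Fin n → X) → X}
    (hg : ∀ i, μ (range (g i)) = 0) {A : TopologicalSpace.NonemptyCompacts X}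
    (hA : (A : Set X) = univ) : ¬ IsGIFSAttractor g A := by
  intro h
  rw [IsGIFSAttractor, hA] at h
  have hzero : μ univ = 0 := by
    rw [← h]
    exact measure_iUnion_null fun i => measure_mono_null (image_subset_range _ _) (hg i)
  exact NeZero.ne μ (Measure.measure_univ_eq_zero.1 hzero)

theorem theorem6p5 :
    (∀ (K q : ℝ) (m : ℕ → ℕ), 0 < K → K < 1 → 0 < q → q < 1 → Monotone m → (∀ k, 0 < m k) →
      -- the construction can be carried out
      Nonempty (SquareConstruction K q m) ∧
      -- and, however it is carried out, the following holds
      ∀ S : SquareConstruction K q m,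
        -- (i)
        (IsGIFSInfty S.gifsMap ∧
          lipFamilySQ q S.gifsMap < ENNReal.ofReal K ∧
          CondQ S.gifsMap ∧
          ∃ A : TopologicalSpace.NonemptyCompacts S.cantorSet,
            (A : Set S.cantorSet) = Set.univ ∧
            IsGIFSInftyAttractor S.gifsMap A ∧
            ∀ B : TopologicalSpace.NonemptyCompacts S.cantorSet,
              IsGIFSInftyAttractor S.gifsMap B → B = A) ∧
        -- (ii)
        (GrowsFast m →
          (∃ μ : MeasureTheory.Measure S.cantorSet, MeasureTheory.IsProbabilityMeasure μ ∧
            ∀ (n : ℕ), 1 ≤ n → ∀ g : (Fin n → S.cantorSet) → S.cantorSet,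
              IsGenWeakContraction g → μ (Set.range g) = 0) ∧
          ∀ A : TopologicalSpace.NonemptyCompacts S.cantorSet, (A : Set S.cantorSet) = Set.univ →
            ∀ (n r : ℕ), 1 ≤ n → ∀ g : Fin r → (Fin n → S.cantorSet) → S.cantorSet,
              (∀ i, IsGenWeakContraction (g i)) → ¬ IsGIFSAttractor g A)) ∧
    -- sequences as in (ii) exist
    ∃ m : ℕ → ℕ, Monotone m ∧ (∀ k, 0 < m k) ∧ GrowsFast m := by 
  refine ⟨fun K q m hK hK1 hq hq1 _ hm => ⟨SquareConstruction.nonempty hK hK1 hq hq1 hm,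
    fun S => ⟨⟨S.isGIFSInfty, S.lipFamilySQ_gifsMap_lt hK hq hq1, S.condQ_gifsMap hK hK1 hq hq1,
      S.exists_unique_attractor⟩, fun hgrow => ?_⟩⟩, exists_growsFast⟩
  have hδ : ∀ k, √2 * S.p k ≤ S.a k := fun k => (S.diam_lt_gap hK1.le hq.le hq1.le k).le
  refine ⟨⟨S.uniform, inferInstance, fun n _ g hg => S.uniform_range_eq_zero hδ hgrow hg⟩,
    fun A hA n r _ g hg => ?_⟩
  exact not_isGIFSAttractor_of_measure_range_eq_zero (μ := S.uniform)
    (fun i => S.uniform_range_eq_zero hδ hgrow (hg i)) hA
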